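/- Let $n\ge 2$ and let $\Omega\subset\mathbb R^n$ be either a bounded Lipschitz domain or an exterior Lipschitz domain, i.e. $\Omega=\mathbb R^n\setminus\overline{\Omega_0}$ with $\Omega_0$ a bounded Lipschitz domain. For $s\ge 0$ let $H^s(\Omega)$ be the $L^2$-based (complex) Sobolev space of order $s$, i.e. the space of restrictions to $\Omega$ of elements of $H^s(\mathbb R^n)$ with norm $\|f\|_{H^s(\Omega)}=\inf\{\|F\|_{H^s(\mathbb R^n)}: F|_\Omega=f\}$, and let $H^s_\Delta(\Omega)=\{f\in H^s(\Omega):\Delta f\in L^2(\Omega)\}$, with $\Delta f$ taken in the sense of distributions on $\Omega$. (1) Let $s>0$ and let $W\in L^p(\Omega)$ be complex-valued, where $p\ge n/s$ if $n>2s$ and $p>2$ if $n\le 2s$ ($p=\infty$ is allowed). Then $Wf,\overline{W}f\in L^2(\Omega)$ for all $f\in H^s(\Omega)$, and for every $\varepsilon>0$ there exists $C_\varepsilon>0$ such that $$\|Wf\|_{L^2(\Omega)}=\|\overline{W}f\|_{L^2(\Omega)}\le \varepsilon\|f\|_{H^s(\Omega)}+C_\varepsilon\|f\|_{L^2(\Omega)},\qquad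 f\in H^s(\Omega).$$ (2) In particular, if $V\in L^p(\Omega)$ is complex-valued, where $p\ge 2n/3$ if $n>3$ and $p>2$ if $n\in\{2,3\}$ ($p=\infty$ is allowed), then the statements in (1) hold for $s=3/2$ and $W=V$; moreover, $$H^{3/2}_\Delta(\Omega)=\{f\in H^{3/2}(\Omega):-\Delta f+Vf\in L^2(\Omega)\}=\{f\in H^{3/2}(\Omega):-\Delta f+\overline{V}f\in L^2(\Omega)\},$$ where $-\Delta f+Vf$ and $-\Delta f+\overline{V}f$ are understood as distributions on $\Omega$. -/

import Mathlib

open MeasureTheory TopologicalSpace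
open scoped ENNReal NNReal ComplexConjugate Distributions SchwartzMap LineDeriv RealInnerProductSpace

noncomputable section

namespace SobolevMult

/-- Euclidean space of dimension `n`. -/
abbrev Euc (n : ℕ) : Type := EuclideanSpace ℝ (Fin n)

/-- The complex space `L²(Ω)`, with respect to Lebesgue measure on `Ω`. -/
abbrev L2 {n : ℕ} (Ω : Opens (Euc n)) : Type :=
  Lp ℂ 2 ((volume : Measure (Euc n)).restrict (Ω : Set (Euc n)))

/-! ### Lipschitz domains -/

/-- A bounded Lipschitz domain: a bounded open set which, near each of its boundary points,
coincides with the strict hypograph of a Lipschitz function in suitable Cartesian coordinates.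
Here `ν` is the unit vector in the vertical direction, and the graph function `φ` is defined on
the hyperplane orthogonal to `ν`. The boundary is compact, so that finitely many of the
neighbourhoods `U` cover it. Connectedness is not required. -/
def IsBoundedLipschitz {n : ℕ} (Ω : Opens (Euc n)) : Prop :=
  Bornology.IsBounded (Ω : Set (Euc n)) ∧
  ∀ x ∈ frontier (Ω : Set (Euc n)),
    ∃ U : Opens (Euc n), x ∈ U ∧
    ∃ (ν : Euc n) (φ : (ℝ ∙ ν)ᗮ → ℝ) (K : ℝ≥0), ‖ν‖ = 1 ∧ LipschitzWith K φ ∧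
      ∀ y ∈ U, y ∈ Ω ↔ ⟪ν, y⟫ < φ ((ℝ ∙ ν)ᗮ.orthogonalProjectionOnto y)

/-- An exterior Lipschitz domain: the complement of the closure of a bounded Lipschitz domain. -/
def IsExteriorLipschitz {n : ℕ} (Ω : Opens (Euc n)) : Prop :=
  ∃ Ω₀ : Opens (Euc n), IsBoundedLipschitz Ω₀ ∧
    (Ω : Set (Euc n)) = (closure (Ω₀ : Set (Euc n)))ᶜ

/-! ### Sobolev spaces -/

/-- `F ∈ L²(ℝⁿ)` belongs to `H^s(ℝⁿ)`, with Bessel potential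
`𝓕⁻¹ ((1 + |ξ|²)^{s/2} 𝓕 F) = G ∈ L²(ℝⁿ)`. The norm of `F` in `H^s(ℝⁿ)` is then `‖G‖_{L²}`. -/
def HasBessel {n : ℕ} (s : ℝ) (F G : Lp ℂ 2 (volume : Measure (Euc n))) : Prop :=
  TemperedDistribution.besselPotential (Euc n) ℂ s (F : 𝓢'(Euc n, ℂ)) = (G : 𝓢'(Euc n, ℂ))

/-- `F`, defined on `ℝⁿ`, restricts to `f` on `Ω`. -/
def Restricts {n : ℕ} {Ω : Opens (Euc n)} (F : Lp ℂ 2 (volume : Measure (Euc n)))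
    (f : L2 Ω) : Prop :=
  F =ᵐ[(volume : Measure (Euc n)).restrict (Ω : Set (Euc n))] f

/-- The Sobolev space `H^s(Ω)`, `s ≥ 0`: the restrictions to `Ω` of the elements of
`H^s(ℝⁿ)`. -/
def Hs {n : ℕ} (s : ℝ) (Ω : Opens (Euc n)) : Set (L2 Ω) :=
  {f | ∃ F : Lp ℂ 2 (volume : Measure (Euc n)),
    TemperedDistribution.MemSobolev s 2 (F : 𝓢'(Euc n, ℂ)) ∧ Restricts F f}

/-- The norm of `H^s(Ω)`: the infimum of the `H^s(ℝⁿ)`-norms of all extensions. It is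
meaningful for `f ∈ Hs s Ω`. -/
def hsNorm {n : ℕ} (s : ℝ) {Ω : Opens (Euc n)} (f : L2 Ω) : ℝ :=
  sInf {r : ℝ | ∃ F G : Lp ℂ 2 (volume : Measure (Euc n)),
    HasBessel s F G ∧ Restricts F f ∧ r = ‖G‖}

/-! ### Distributions on `Ω` -/

/-- The regular distribution `φ ↦ ∫_Ω φ u` on `Ω` of a locally integrable function `u`. -/
def toDistr {n : ℕ} (Ω : Opens (Euc n)) (u : Euc n → ℂ) : 𝓓'(Ω, ℂ) :=
  ContinuousLinearMap.toUniformConvergenceCLM _ _ _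
    (TestFunction.integralAgainstBilinCLM (ContinuousLinearMap.lsmul ℝ ℝ : ℝ →L[ℝ] ℂ →L[ℝ] ℂ)
      ((volume : Measure (Euc n)).restrict (Ω : Set (Euc n))) u)

/-- The Laplacian of a distribution on `Ω`. -/
def laplace {n : ℕ} {Ω : Opens (Euc n)} (T : 𝓓'(Ω, ℂ)) : 𝓓'(Ω, ℂ) :=
  ∑ i : Fin n, ∂_{EuclideanSpace.single i (1 : ℝ)} (∂_{EuclideanSpace.single i (1 : ℝ)} T)

/-- The distribution `T` on `Ω` belongs to `L²(Ω)`. -/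
def InL2 {n : ℕ} {Ω : Opens (Euc n)} (T : 𝓓'(Ω, ℂ)) : Prop :=
  ∃ g : L2 Ω, T = toDistr Ω g

/-- The space `H^s_Δ(Ω) = {f ∈ H^s(Ω) : Δ f ∈ L²(Ω)}`. -/
def HsLaplace {n : ℕ} (s : ℝ) (Ω : Opens (Euc n)) : Set (L2 Ω) :=
  {f | f ∈ Hs s Ω ∧ InL2 (laplace (toDistr Ω f))}

/-- The space `{f ∈ H^s(Ω) : -Δ f + V f ∈ L²(Ω)}`, where `-Δ f + V f` is understood in the sense of
distributions on `Ω`. It is used for `V ∈ L^p(Ω)` with `p ≥ 2` only; then `V f` is locally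
integrable for every `f ∈ L²(Ω)`. -/
def HsSchrodinger {n : ℕ} (s : ℝ) (Ω : Opens (Euc n)) (V : Euc n → ℂ) : Set (L2 Ω) :=
  {f | f ∈ Hs s Ω ∧ InL2 (-laplace (toDistr Ω f) + toDistr Ω (fun x ↦ V x * f x))}

/-- Multiplication by `W` and by its complex conjugate maps `H^s(Ω)` into `L²(Ω)`, and for every
`ε > 0` there is `C > 0` with
`‖W f‖_{L²} = ‖conj W f‖_{L²} ≤ ε ‖f‖_{H^s} + C ‖f‖_{L²}` for all `f ∈ H^s(Ω)`. -/
def MulBound {n : ℕ} (s : ℝ) (Ω : Opens (Euc n)) (W : Euc n → ℂ) : Prop :=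
  (∀ f ∈ Hs s Ω,
    MemLp (fun x ↦ W x * f x) 2 ((volume : Measure (Euc n)).restrict (Ω : Set (Euc n))) ∧
    MemLp (fun x ↦ conj (W x) * f x) 2
      ((volume : Measure (Euc n)).restrict (Ω : Set (Euc n)))) ∧
  ∀ ε : ℝ, 0 < ε → ∃ C : ℝ, 0 < C ∧ ∀ f ∈ Hs s Ω,
    (eLpNorm (fun x ↦ W x * f x) 2
      ((volume : Measure (Euc n)).restrict (Ω : Set (Euc n)))).toReal =
    (eLpNorm (fun x ↦ conj (W x) * f x) 2
      ((volume : Measure (Euc n)).restrict (Ω : Set (Euc n)))).toReal ∧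
    (eLpNorm (fun x ↦ W x * f x) 2
      ((volume : Measure (Euc n)).restrict (Ω : Set (Euc n)))).toReal
      ≤ ε * hsNorm s f + C * ‖f‖

end SobolevMult

end

/-! Part (1) rests on the fractional Sobolev embedding of `H^s(ℝⁿ)` into `L^q(ℝⁿ)`, where `1/q = 1/2
- t/n`, `0 < t ≤ s` and `2t < n` (`SobolevMult.HasBessel.eLpNorm_le`). For finite `p` take `t =
n/p`, so that `1/p + 1/q = 1/2`. Split `W` into a simple function and a remainder small in `L^p`. By
Hölder and the embedding, the remainder contributes `ε ‖f‖_{H^s}`, while the bounded simple function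
contributes `C ‖f‖_{L²}`. A bounded `W` needs no splitting. The estimates hold for every extension
of `f`, hence for the infimum defining the norm on `Ω`.

The embedding is proved by real interpolation on the Fourier side. At each level `l` the frequencies
are cut at a radius depending on `l`: the low part is at most `l/2` pointwise, the high part is
controlled by Chebyshev and Plancherel, and integration over `l` gives the `L^q` norm.

Part (2) follows because adding a function of `L²(Ω)` does not affect whether a distribution lies in
`L²(Ω)`. -/

/-! ### Fourier transform and Bessel potentials on `L²`. -/

open FourierTransform Metric in
/-- The inverse Fourier transform of an integrable function in `L²` is bounded by the `L¹` norm. -/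
theorem SobolevMult.enorm_fourierInv_le_lintegral {n : ℕ}
    (h : Lp ℂ 2 (volume : Measure (SobolevMult.Euc n))) :
    ∀ᵐ x, ‖(𝓕⁻ h : Lp ℂ 2 (volume : Measure (SobolevMult.Euc n))) x‖ₑ ≤ ∫⁻ ξ, ‖h ξ‖ₑ := by
  by_cases hfin : ∫⁻ ξ, ‖h ξ‖ₑ = ∞
  · simp [hfin]
  have hint : Integrable h := ⟨(Lp.memLp h).aestronglyMeasurable, lt_top_iff_ne_top.2 hfin⟩
  have hcont : Continuous (𝓕⁻ (h : SobolevMult.Euc n → ℂ)) := by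
    rw [Real.fourierInv_eq_fourier_comp_neg]
    exact VectorFourier.fourierIntegral_continuous Real.continuous_fourierChar
      (innerSL ℝ).continuous₂ hint.comp_neg
  -- The `L²` transform is not given by an integral, so it is identified with the integral formula
  -- by testing against smooth compactly supported functions and moving `𝓕⁻` onto the test function.
  have key : ∀ᵐ x, (𝓕⁻ h : Lp ℂ 2 (volume : Measure (SobolevMult.Euc n))) x =
      𝓕⁻ (h : SobolevMult.Euc n → ℂ) x := by
    apply ae_eq_of_integral_contDiff_smul_eq
    · exact (Lp.memLp _).locallyIntegrable (by norm_num)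
    · exact hcont.locallyIntegrable
    intro g g_smooth g_cpt
    have hg₁ : HasCompactSupport (Complex.ofRealCLM ∘ g) := g_cpt.comp_left rfl
    have hg₂ : ContDiff ℝ (⊤ : ℕ∞) (Complex.ofRealCLM ∘ g) := by fun_prop
    set G : 𝓢(SobolevMult.Euc n, ℂ) := hg₁.toSchwartzMap hg₂ with hG
    have e1 : ((𝓕⁻ h : Lp ℂ 2 (volume : Measure (SobolevMult.Euc n))) :
        𝓢'(SobolevMult.Euc n, ℂ)) G = (h : 𝓢'(SobolevMult.Euc n, ℂ)) (𝓕⁻ G) := by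
      rw [← Lp.fourierInv_toTemperedDistribution_eq, TemperedDistribution.fourierInv_apply]
    have e2 : ∫ ξ, (𝓕⁻ (G : SobolevMult.Euc n → ℂ)) ξ • h ξ =
        ∫ x, G x • 𝓕⁻ (h : SobolevMult.Euc n → ℂ) x := by
      -- `𝓕⁻` is the Fourier integral for the negated inner product, so the general exchange formula
      -- is applied to that symmetric form.
      have hneg : Continuous fun p : SobolevMult.Euc n × SobolevMult.Euc n ↦
          (-innerₗ (SobolevMult.Euc n)) p.1 p.2 := by
        simp only [LinearMap.neg_apply, innerₗ_apply_apply]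
        fun_prop
      have := VectorFourier.integral_fourierIntegral_smul_eq_flip (μ := volume) (ν := volume)
        (L := -innerₗ (SobolevMult.Euc n)) Real.continuous_fourierChar hneg G.integrable hint
      have hflip : (-innerₗ (SobolevMult.Euc n)).flip = -innerₗ (SobolevMult.Euc n) := by
        ext x y; simp [real_inner_comm]
      rw [hflip] at this
      exact this
    rw [Lp.toTemperedDistribution_apply, Lp.toTemperedDistribution_apply] at e1
    simp only [SchwartzMap.fourierInv_coe] at e1
    rw [e2] at e1
    simpa [hG] using e1
  filter_upwards [key] with x hx
  rw [hx, Real.fourierInv_eq]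
  refine (enorm_integral_le_lintegral_enorm _).trans (le_of_eq ?_)
  refine lintegral_congr fun ξ ↦ ?_
  rw [← ofReal_norm, ← ofReal_norm, Circle.norm_smul]

open FourierTransform in
/-- On the Fourier side the Bessel potential of negative order is a pointwise multiplication. -/
theorem SobolevMult.HasBessel.fourier_ae_eq {n : ℕ} {s : ℝ} (hs : 0 ≤ s)
    {F G : Lp ℂ 2 (volume : Measure (SobolevMult.Euc n))} (h : SobolevMult.HasBessel s F G) :
    ∀ᵐ ξ, (𝓕 F : Lp ℂ 2 (volume : Measure (SobolevMult.Euc n))) ξ =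
      (((1 + ‖ξ‖ ^ 2) ^ (-s / 2) : ℝ) : ℂ) *
        (𝓕 G : Lp ℂ 2 (volume : Measure (SobolevMult.Euc n))) ξ := by
  -- The potential is inverted first: the symbol of order `-s` is bounded, so its product with `𝓕 G`
  -- stays in `L²`, and the identity of distributions becomes one of functions.
  have h1 := (TemperedDistribution.besselPotential_neg_apply_eq_iff s
    (G : 𝓢'(SobolevMult.Euc n, ℂ)) (F : 𝓢'(SobolevMult.Euc n, ℂ))).2 h
  apply_fun 𝓕 at h1
  rw [TemperedDistribution.fourier_besselPotential_eq_smulLeftCLM_fourier_apply,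
    Lp.fourier_toTemperedDistribution_eq, Lp.fourier_toTemperedDistribution_eq] at h1
  set m : SobolevMult.Euc n → ℂ := fun x ↦ (((1 + ‖x‖ ^ 2) ^ (-s / 2) : ℝ) : ℂ) with hm
  have hmt : m.HasTemperateGrowth := by fun_prop
  have hmb : MemLp m ∞ := by
    refine memLp_top_of_bound hmt.1.continuous.aestronglyMeasurable 1 (.of_forall fun x ↦ ?_)
    rw [hm, Complex.norm_real, Real.norm_eq_abs, abs_of_nonneg (by positivity)]
    exact Real.rpow_le_one_of_one_le_of_nonpos (by nlinarith [sq_nonneg ‖x‖]) (by linarith)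
  rw [← Lp.toTemperedDistribution_smul_eq (r := 2) hmt hmb] at h1
  have h2 : (hmb.toLp • (𝓕 G) : Lp ℂ 2 (volume : Measure (SobolevMult.Euc n))) = 𝓕 F :=
    LinearMap.ker_eq_bot.1 (Lp.ker_toTemperedDistributionCLM_eq_bot (F := ℂ)
      (μ := (volume : Measure (SobolevMult.Euc n))) (p := 2)) h1
  rw [← h2]
  filter_upwards [Lp.coeFn_lpSMul (r := 2) hmb.toLp (𝓕 G), hmb.coeFn_toLp] with x hx hx'
  rw [hx, Pi.smul_apply', hx', smul_eq_mul]

/-! ### The fractional Sobolev inequality. -/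

-- Polar coordinates; `2t < n` gives integrability at the origin, and `K` does not depend on the
-- radius.
open Metric Set in
theorem SobolevMult.lintegral_ball_norm_rpow {n : ℕ} [NeZero n] {t : ℝ} (h2t : 2 * t < n) :
    ∃ K : ℝ, 0 ≤ K ∧ ∀ A : ℝ, 0 < A →
      ∫⁻ ξ in ball (0 : SobolevMult.Euc n) A, ENNReal.ofReal (‖ξ‖ ^ (-(2 * t))) =
        ENNReal.ofReal (K * A ^ (n - 2 * t)) := by
  have hn : 1 ≤ n := Nat.one_le_iff_ne_zero.2 (NeZero.ne n)
  have : Nontrivial (SobolevMult.Euc n) :=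
    Module.nontrivial_of_finrank_pos (R := ℝ) (by simp; omega)
  set v := (volume : Measure (SobolevMult.Euc n)).real (ball 0 1)
  refine ⟨n * v / (n - 2 * t), div_nonneg (by positivity) (by linarith), fun A hA ↦ ?_⟩
  have hpow : ∀ y ∈ Ioo (0 : ℝ) A, y ^ (n - 1) • y ^ (-(2 * t)) = y ^ ((n : ℝ) - 1 - 2 * t) := by
    intro y hy
    rw [smul_eq_mul, ← Real.rpow_natCast, ← Real.rpow_add hy.1, Nat.cast_sub hn]
    congr 1
    push_cast
    ring
  have hint1 : IntegrableOn (fun y : ℝ ↦ y ^ ((n : ℝ) - 1 - 2 * t)) (Ioo 0 A) :=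
    ((intervalIntegral.intervalIntegrable_rpow' (by linarith)).1).mono_set Ioo_subset_Ioc_self
  have hint : IntegrableOn (fun x : SobolevMult.Euc n ↦ ‖x‖ ^ (-(2 * t))) (ball 0 A) := by
    rw [integrableOn_fun_norm_addHaar volume (f := fun y ↦ y ^ (-(2 * t))), finrank_euclideanSpace,
      Fintype.card_fin]
    exact (integrableOn_congr_fun hpow measurableSet_Ioo).2 hint1
  rw [← ofReal_integral_eq_lintegral_ofReal hint (.of_forall fun x ↦ by positivity)]
  congr 1
  have e : ∀ x : SobolevMult.Euc n, (ball (0 : SobolevMult.Euc n) A).indicator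
      (fun x ↦ ‖x‖ ^ (-(2 * t))) x = (Iio A).indicator (fun y ↦ y ^ (-(2 * t))) ‖x‖ := by
    intro x
    simp [indicator]
  rw [← integral_indicator measurableSet_ball]
  simp_rw [e]
  rw [integral_fun_norm_addHaar volume (f := (Iio A).indicator (fun y : ℝ ↦ y ^ (-(2 * t)))),
    finrank_euclideanSpace, Fintype.card_fin]
  have e2 : ∀ y : ℝ, y ^ (n - 1) • (Iio A).indicator (fun y : ℝ ↦ y ^ (-(2 * t))) y =
      (Iio A).indicator (fun y : ℝ ↦ y ^ (n - 1) • y ^ (-(2 * t))) y := by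
    intro y
    by_cases hy : y ∈ Iio A <;> simp [hy]
  simp_rw [e2]
  rw [setIntegral_indicator measurableSet_Iio, Ioi_inter_Iio,
    setIntegral_congr_fun measurableSet_Ioo hpow, ← integral_Ioc_eq_integral_Ioo,
    ← intervalIntegral.integral_of_le hA.le, integral_rpow (Or.inl (by linarith)),
    Real.zero_rpow (by linarith)]
  have : (n : ℝ) - 1 - 2 * t + 1 = n - 2 * t := by ring
  rw [this, nsmul_eq_mul, smul_eq_mul]
  ring

-- Cauchy–Schwarz against the weight `‖ξ‖ ^ (-t)`. This bounds the low frequencies of `h` in `L¹`,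
-- hence their inverse transform pointwise.
open Metric Set in
theorem SobolevMult.lintegral_ball_enorm_le {n : ℕ} [NeZero n] {t : ℝ} (h2t : 2 * t < n) :
    ∃ K : ℝ, 0 < K ∧ ∀ (h g : Lp ℂ 2 (volume : Measure (SobolevMult.Euc n))),
      (∀ᵐ ξ, ‖ξ‖ ^ t * ‖h ξ‖ ≤ ‖g ξ‖) → ∀ A : ℝ, 0 < A →
      ∫⁻ ξ in ball (0 : SobolevMult.Euc n) A, ‖h ξ‖ₑ ≤
        ENNReal.ofReal (K * A ^ (n / 2 - t) * ‖g‖) := by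
  obtain ⟨K, hK, hKA⟩ := SobolevMult.lintegral_ball_norm_rpow (n := n) h2t
  have hn : 1 ≤ n := Nat.one_le_iff_ne_zero.2 (NeZero.ne n)
  have : Nontrivial (SobolevMult.Euc n) :=
    Module.nontrivial_of_finrank_pos (R := ℝ) (by simp; omega)
  -- The `+ 1` only makes the constant positive, since it is later divided by.
  refine ⟨√K + 1, by positivity, fun h g hhg A hA ↦ ?_⟩
  have h1 : ∫⁻ ξ in ball (0 : SobolevMult.Euc n) A, ‖h ξ‖ₑ ≤
      ∫⁻ ξ in ball (0 : SobolevMult.Euc n) A, (ENNReal.ofReal (‖ξ‖ ^ (-t)) * ‖g ξ‖ₑ) := by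
    refine lintegral_mono_ae (ae_restrict_of_ae ?_)
    filter_upwards [hhg, compl_mem_ae_iff.2 (measure_singleton (0 : SobolevMult.Euc n))]
      with ξ hξ hξ0
    have hpos : 0 < ‖ξ‖ := norm_pos_iff.2 hξ0
    rw [← ofReal_norm, ← ofReal_norm, ← ENNReal.ofReal_mul (by positivity)]
    refine ENNReal.ofReal_le_ofReal ?_
    rw [Real.rpow_neg hpos.le, ← div_eq_inv_mul, le_div_iff₀ (by positivity), mul_comm]
    exact hξ
  have hg : (∫⁻ ξ in ball (0 : SobolevMult.Euc n) A, ‖g ξ‖ₑ ^ (2 : ℝ)) ^ (1 / 2 : ℝ) ≤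
      ENNReal.ofReal ‖g‖ := by
    rw [Lp.norm_def, ENNReal.ofReal_toReal (Lp.eLpNorm_ne_top g),
      eLpNorm_eq_lintegral_rpow_enorm_toReal (by norm_num) (by norm_num)]
    simp only [ENNReal.toReal_ofNat]
    gcongr
    exact Measure.restrict_le_self
  have hw : (∫⁻ ξ in ball (0 : SobolevMult.Euc n) A, ENNReal.ofReal (‖ξ‖ ^ (-t)) ^ (2 : ℝ)) ^
      (1 / 2 : ℝ) = ENNReal.ofReal (√K * A ^ (n / 2 - t)) := by
    have : ∀ ξ : SobolevMult.Euc n, ENNReal.ofReal (‖ξ‖ ^ (-t)) ^ (2 : ℝ) =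
        ENNReal.ofReal (‖ξ‖ ^ (-(2 * t))) := by
      intro ξ
      rw [ENNReal.ofReal_rpow_of_nonneg (by positivity) (by norm_num),
        ← Real.rpow_mul (norm_nonneg _)]
      congr 2
      ring
    simp_rw [this]
    rw [hKA A hA, ENNReal.ofReal_rpow_of_nonneg (by positivity) (by norm_num),
      Real.mul_rpow hK (by positivity), ← Real.rpow_mul hA.le, Real.sqrt_eq_rpow]
    congr 3
    ring
  refine h1.trans ((ENNReal.lintegral_mul_le_Lp_mul_Lq _ .two_two ?_ ?_).trans ?_)
  · fun_prop
  · exact (Lp.aestronglyMeasurable g).enorm.restrict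
  rw [hw]
  refine (mul_le_mul_right hg _).trans ?_
  rw [← ENNReal.ofReal_mul (by positivity)]
  refine ENNReal.ofReal_le_ofReal ?_
  gcongr
  linarith

open FourierTransform Metric Set in
/-- A weak-type estimate, obtained by splitting the frequencies at radius `A`. -/
theorem SobolevMult.measure_lt_norm_fourierInv_le {n : ℕ}
    (h : Lp ℂ 2 (volume : Measure (SobolevMult.Euc n))) {A l : ℝ} (hl : 0 < l)
    (hA : ∫⁻ ξ in ball (0 : SobolevMult.Euc n) A, ‖h ξ‖ₑ ≤ ENNReal.ofReal (l / 2)) :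
    volume {x | l < ‖(𝓕⁻ h : Lp ℂ 2 (volume : Measure (SobolevMult.Euc n))) x‖} ≤
      ENNReal.ofReal (4 / l ^ 2) * ∫⁻ ξ in (ball (0 : SobolevMult.Euc n) A)ᶜ, ‖h ξ‖ₑ ^ (2 : ℝ) := by
  have hmL := (Lp.memLp h).indicator (measurableSet_ball (x := (0 : SobolevMult.Euc n)) (ε := A))
  have hmH := (Lp.memLp h).indicator
    (measurableSet_ball (x := (0 : SobolevMult.Euc n)) (ε := A)).compl
  set L := hmL.toLp
  set H := hmH.toLp
  have hLH : h = L + H := by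
    ext1
    filter_upwards [Lp.coeFn_add L H, hmL.coeFn_toLp, hmH.coeFn_toLp] with x h1 h2 h3
    rw [h1, Pi.add_apply, h2, h3]
    exact (congrFun (indicator_self_add_compl (ball (0 : SobolevMult.Euc n) A) h) x).symm
  have hL : ∫⁻ ξ, ‖L ξ‖ₑ ≤ ENNReal.ofReal (l / 2) := by
    refine le_trans (le_of_eq ?_) hA
    rw [← lintegral_indicator measurableSet_ball]
    refine lintegral_congr_ae ?_
    filter_upwards [hmL.coeFn_toLp] with x hx
    rw [hx, enorm_indicator_eq_indicator_enorm]
  have hH : ∫⁻ x, ‖(𝓕⁻ H : Lp ℂ 2 (volume : Measure (SobolevMult.Euc n))) x‖ₑ ^ (2 : ℝ) =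
      ∫⁻ ξ in (ball (0 : SobolevMult.Euc n) A)ᶜ, ‖h ξ‖ₑ ^ (2 : ℝ) := by
    have hnorm : ‖(𝓕⁻ H : Lp ℂ 2 (volume : Measure (SobolevMult.Euc n)))‖ = ‖H‖ := by
      rw [← Lp.norm_fourier_eq, fourier_fourierInv_eq]
    rw [Lp.norm_def, Lp.norm_def, ENNReal.toReal_eq_toReal_iff' (Lp.eLpNorm_ne_top _)
      (Lp.eLpNorm_ne_top _), eLpNorm_eq_lintegral_rpow_enorm_toReal (by norm_num) (by norm_num),
      eLpNorm_eq_lintegral_rpow_enorm_toReal (by norm_num) (by norm_num)] at hnorm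
    simp only [ENNReal.toReal_ofNat] at hnorm
    rw [(ENNReal.rpow_left_injective (by norm_num : (1 / 2 : ℝ) ≠ 0)) hnorm,
      ← lintegral_indicator measurableSet_ball.compl]
    refine lintegral_congr_ae ?_
    filter_upwards [hmH.coeFn_toLp] with x hx
    rw [hx]
    by_cases hxA : x ∈ (ball (0 : SobolevMult.Euc n) A)ᶜ
    · simp only [indicator_of_mem hxA]
    · simp only [indicator_of_notMem hxA]
      simp
  -- The low part is at most `l / 2`, so where the sum exceeds `l` the high part exceeds `l / 2`;
  -- its square is then at least `l ^ 2 / 4`.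
  have hsub : volume {x | l < ‖(𝓕⁻ h : Lp ℂ 2 (volume : Measure (SobolevMult.Euc n))) x‖} ≤
      volume {x | ENNReal.ofReal (l ^ 2 / 4) ≤
        ‖(𝓕⁻ H : Lp ℂ 2 (volume : Measure (SobolevMult.Euc n))) x‖ₑ ^ (2 : ℝ)} := by
    refine measure_mono_ae ?_
    have hadd : (𝓕⁻ h : Lp ℂ 2 (volume : Measure (SobolevMult.Euc n))) = 𝓕⁻ L + 𝓕⁻ H := by
      rw [← FourierTransform.fourierInv_add, ← hLH]
    filter_upwards [SobolevMult.enorm_fourierInv_le_lintegral L,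
      Lp.coeFn_add (𝓕⁻ L : Lp ℂ 2 (volume : Measure (SobolevMult.Euc n))) (𝓕⁻ H)]
      with x h1 h2 h3
    have h3' : l < ‖(𝓕⁻ h : Lp ℂ 2 (volume : Measure (SobolevMult.Euc n))) x‖ := h3
    rw [hadd, h2, Pi.add_apply] at h3'
    have h4 := h1.trans hL
    rw [← ofReal_norm, ENNReal.ofReal_le_ofReal_iff (by positivity)] at h4
    have h5 := norm_add_le ((𝓕⁻ L : Lp ℂ 2 (volume : Measure (SobolevMult.Euc n))) x)
      ((𝓕⁻ H : Lp ℂ 2 (volume : Measure (SobolevMult.Euc n))) x)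
    change ENNReal.ofReal (l ^ 2 / 4) ≤
        ‖(𝓕⁻ H : Lp ℂ 2 (volume : Measure (SobolevMult.Euc n))) x‖ₑ ^ (2 : ℝ)
    rw [← ofReal_norm, ENNReal.ofReal_rpow_of_nonneg (norm_nonneg _) (by norm_num)]
    refine ENNReal.ofReal_le_ofReal ?_
    rw [Real.rpow_two]
    nlinarith
  have hcheb := mul_meas_ge_le_lintegral₀ (μ := volume)
    ((Lp.aestronglyMeasurable (𝓕⁻ H : Lp ℂ 2 (volume : Measure (SobolevMult.Euc n)))).enorm.pow_const
      (2 : ℝ)) (ENNReal.ofReal (l ^ 2 / 4))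
  rw [hH] at hcheb
  refine hsub.trans ?_
  refine le_trans (le_of_eq ?_) (mul_le_mul_right hcheb _)
  rw [← mul_assoc, ← ENNReal.ofReal_mul (by positivity)]
  rw [show 4 / l ^ 2 * (l ^ 2 / 4) = 1 by field_simp]
  simp

open Set in
theorem lintegral_Ioc_rpow {R r : ℝ} (hR : 0 ≤ R) (hr : -1 < r) :
    ∫⁻ l in Ioc 0 R, ENNReal.ofReal (l ^ r) = ENNReal.ofReal (R ^ (r + 1) / (r + 1)) := by
  have hint : IntegrableOn (fun l : ℝ ↦ l ^ r) (Ioc 0 R) :=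
    (intervalIntegral.intervalIntegrable_rpow' hr).1
  rw [← ofReal_integral_eq_lintegral_ofReal hint]
  · rw [← intervalIntegral.integral_of_le hR, integral_rpow (Or.inl hr),
      Real.zero_rpow (by linarith), sub_zero]
  · filter_upwards [ae_restrict_mem measurableSet_Ioc] with l hl
    exact Real.rpow_nonneg hl.1.le _

-- Layer-cake formula, the weak-type estimate with a level-dependent cutoff, then Tonelli. The
-- exponents match because `a * (q - 2) = 2 * t`.
open FourierTransform Metric Set in
theorem SobolevMult.lintegral_fourierInv_rpow_le {n : ℕ} [NeZero n] {t : ℝ} (ht : 0 < t)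
    (h2t : 2 * t < n) :
    ∃ C : ℝ, 0 < C ∧ ∀ (h g : Lp ℂ 2 (volume : Measure (SobolevMult.Euc n))),
      (∀ᵐ ξ, ‖ξ‖ ^ t * ‖h ξ‖ ≤ ‖g ξ‖) → ∀ M : ℝ, 0 < M → ‖g‖ ≤ M →
      ∫⁻ x, ENNReal.ofReal (‖(𝓕⁻ h : Lp ℂ 2 (volume : Measure (SobolevMult.Euc n))) x‖ ^
        (2 * n / (n - 2 * t))) ≤ ENNReal.ofReal (C * M ^ (2 * n / (n - 2 * t))) := by
  obtain ⟨K, hK, hKA⟩ := SobolevMult.lintegral_ball_enorm_le (n := n) h2t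
  have hd : 0 < n - 2 * t := by linarith
  set q : ℝ := 2 * n / (n - 2 * t) with hq
  set a : ℝ := n / 2 - t with ha
  have ha0 : 0 < a := by rw [ha]; linarith
  have hq2 : q - 2 = 4 * t / (n - 2 * t) := by rw [hq]; field_simp; ring
  have hq2' : 0 < q - 2 := by rw [hq2]; positivity
  have haq : a * (q - 2) = 2 * t := by rw [hq2, ha]; field_simp; ring
  refine ⟨q * (4 / (q - 2) * (2 * K) ^ (q - 2)),
    mul_pos (by linarith) (by positivity), fun h g hhg M hM hgM ↦ ?_⟩
  have hgsq : ∫⁻ ξ, ‖g ξ‖ₑ ^ (2 : ℝ) ≤ ENNReal.ofReal (M ^ 2) := by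
    have h1 : eLpNorm g 2 volume ≤ ENNReal.ofReal M := by
      rw [← ENNReal.ofReal_toReal (Lp.eLpNorm_ne_top g), ← Lp.norm_def]
      exact ENNReal.ofReal_le_ofReal hgM
    rw [eLpNorm_eq_lintegral_rpow_enorm_toReal (by norm_num) (by norm_num)] at h1
    simp only [ENNReal.toReal_ofNat] at h1
    have h2 := ENNReal.rpow_le_rpow h1 (by norm_num : (0 : ℝ) ≤ 2)
    rwa [← ENNReal.rpow_mul, show (1 / 2 : ℝ) * 2 = 1 by norm_num, ENNReal.rpow_one,
      ENNReal.ofReal_rpow_of_nonneg hM.le (by norm_num), Real.rpow_two] at h2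
  -- The frequencies above the cutoff `A = (l / (2KM)) ^ (1/a)`, chosen so that the low-frequency
  -- bound `K * A ^ a * M` equals `l / 2`.
  set T : Set (ℝ × SobolevMult.Euc n) := {p | p.1 ≤ 2 * K * M * ‖p.2‖ ^ a}
  have hT : MeasurableSet T := by
    refine measurableSet_le measurable_fst ?_
    fun_prop
  set f : ℝ → SobolevMult.Euc n → ℝ≥0∞ := fun l ξ ↦
    T.indicator (fun p ↦ ENNReal.ofReal (p.1 ^ (q - 3))) (l, ξ) * ‖h ξ‖ₑ ^ (2 : ℝ) with hf
  have hfm : Measurable (Function.uncurry f) := by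
    refine Measurable.mul ?_ ?_
    · refine Measurable.indicator ?_ hT
      fun_prop
    · exact ((Lp.stronglyMeasurable h).measurable.comp measurable_snd).enorm.pow_const _
  have hweak : ∀ l ∈ Ioi (0 : ℝ),
      volume {x | l < ‖(𝓕⁻ h : Lp ℂ 2 (volume : Measure (SobolevMult.Euc n))) x‖} *
        ENNReal.ofReal (l ^ (q - 1)) ≤ ENNReal.ofReal 4 * ∫⁻ ξ, f l ξ := by
    intro l hl
    have hl : 0 < l := hl
    have hA : 0 < (l / (2 * K * M)) ^ (1 / a) := by positivity
    have hAa : ((l / (2 * K * M)) ^ (1 / a)) ^ a = l / (2 * K * M) := by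
      rw [← Real.rpow_mul (by positivity), one_div_mul_cancel ha0.ne', Real.rpow_one]
    have h1 := SobolevMult.measure_lt_norm_fourierInv_le h hl (A := (l / (2 * K * M)) ^ (1 / a)) (by
      refine (hKA h g hhg _ hA).trans (ENNReal.ofReal_le_ofReal ?_)
      rw [hAa]
      calc K * (l / (2 * K * M)) * ‖g‖ ≤ K * (l / (2 * K * M)) * M := by gcongr
        _ = l / 2 := by field_simp)
    refine (mul_le_mul_left h1 _).trans ?_
    have h2 : ENNReal.ofReal (4 / l ^ 2) * ENNReal.ofReal (l ^ (q - 1)) =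
        ENNReal.ofReal 4 * ENNReal.ofReal (l ^ (q - 3)) := by
      rw [← ENNReal.ofReal_mul (by positivity), ← ENNReal.ofReal_mul (by positivity)]
      congr 1
      rw [show q - 1 = (q - 3) + (2 : ℕ) by push_cast; ring, Real.rpow_add_natCast hl.ne']
      field_simp
    rw [mul_right_comm, h2, mul_assoc, ← lintegral_const_mul' _ _ ENNReal.ofReal_ne_top,
      ← lintegral_indicator measurableSet_ball.compl]
    gcongr with ξ
    by_cases hξ : ξ ∈ (ball (0 : SobolevMult.Euc n) ((l / (2 * K * M)) ^ (1 / a)))ᶜ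
    · rw [indicator_of_mem hξ, hf]
      simp only
      rw [indicator_of_mem]
      have hξ' : (l / (2 * K * M)) ^ (1 / a) ≤ ‖ξ‖ := by simpa using hξ
      have := Real.rpow_le_rpow hA.le hξ' ha0.le
      rw [hAa, div_le_iff₀ (by positivity)] at this
      change l ≤ 2 * K * M * ‖ξ‖ ^ a
      linarith
    · rw [indicator_of_notMem hξ]
      exact zero_le
  -- For fixed `ξ` the levels stop at `2KM‖ξ‖ ^ a`, so integrating `l ^ (q - 3)` produces `‖ξ‖ ^
  -- (2t)`, exactly the weight that `g` absorbs.
  have hinner : ∀ᵐ ξ, ∫⁻ l in Ioi (0 : ℝ), f l ξ ≤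
      ENNReal.ofReal ((2 * K * M) ^ (q - 2) / (q - 2)) * ‖g ξ‖ₑ ^ (2 : ℝ) := by
    filter_upwards [hhg] with ξ hξ
    have e1 : ∫⁻ l in Ioi (0 : ℝ), f l ξ =
        (∫⁻ l in Ioc 0 (2 * K * M * ‖ξ‖ ^ a), ENNReal.ofReal (l ^ (q - 3))) *
          ‖h ξ‖ₑ ^ (2 : ℝ) := by
      rw [hf]
      simp only
      rw [lintegral_mul_const' _ _ (by finiteness)]
      congr 1
      have : ∀ l : ℝ, T.indicator (fun p ↦ ENNReal.ofReal (p.1 ^ (q - 3))) (l, ξ) =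
          (Iic (2 * K * M * ‖ξ‖ ^ a)).indicator (fun l ↦ ENNReal.ofReal (l ^ (q - 3))) l := by
        intro l
        simp [T, indicator]
      simp_rw [this]
      rw [setLIntegral_indicator measurableSet_Iic, inter_comm, Ioi_inter_Iic]
    rw [e1, lintegral_Ioc_rpow (by positivity) (by linarith),
      show q - 3 + 1 = q - 2 by ring, Real.mul_rpow (by positivity) (by positivity),
      ← Real.rpow_mul (norm_nonneg _), haq, mul_div_right_comm,
      ENNReal.ofReal_mul (by positivity), mul_assoc]
    gcongr
    rw [← ofReal_norm, ← ofReal_norm, ENNReal.ofReal_rpow_of_nonneg (norm_nonneg _) (by norm_num),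
      ENNReal.ofReal_rpow_of_nonneg (norm_nonneg _) (by norm_num),
      ← ENNReal.ofReal_mul (by positivity)]
    refine ENNReal.ofReal_le_ofReal ?_
    rw [mul_comm 2 t, Real.rpow_mul (norm_nonneg _), ← Real.mul_rpow (by positivity) (by positivity)]
    exact Real.rpow_le_rpow (by positivity) hξ (by norm_num)
  rw [lintegral_rpow_eq_lintegral_meas_lt_mul volume (.of_forall fun x ↦ norm_nonneg _)
    (Lp.aestronglyMeasurable _).norm.aemeasurable (by linarith : 0 < q)]
  calc ENNReal.ofReal q * ∫⁻ l in Ioi (0 : ℝ),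
        volume {x | l < ‖(𝓕⁻ h : Lp ℂ 2 (volume : Measure (SobolevMult.Euc n))) x‖} *
          ENNReal.ofReal (l ^ (q - 1))
      ≤ ENNReal.ofReal q * ∫⁻ l in Ioi (0 : ℝ), ENNReal.ofReal 4 * ∫⁻ ξ, f l ξ := by
        gcongr 1
        exact setLIntegral_mono' measurableSet_Ioi hweak
    _ = ENNReal.ofReal q * (ENNReal.ofReal 4 * ∫⁻ ξ, ∫⁻ l in Ioi (0 : ℝ), f l ξ) := by
        rw [lintegral_const_mul' _ _ ENNReal.ofReal_ne_top,
          lintegral_lintegral_swap hfm.aemeasurable]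
    _ ≤ ENNReal.ofReal q * (ENNReal.ofReal 4 *
          ∫⁻ ξ, ENNReal.ofReal ((2 * K * M) ^ (q - 2) / (q - 2)) * ‖g ξ‖ₑ ^ (2 : ℝ)) := by
        gcongr 2
        exact lintegral_mono_ae hinner
    _ ≤ ENNReal.ofReal q * (ENNReal.ofReal 4 *
          (ENNReal.ofReal ((2 * K * M) ^ (q - 2) / (q - 2)) * ENNReal.ofReal (M ^ 2))) := by
        rw [lintegral_const_mul' _ _ ENNReal.ofReal_ne_top]
        gcongr
    _ = ENNReal.ofReal (q * (4 / (q - 2) * (2 * K) ^ (q - 2)) * M ^ q) := by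
        rw [← ENNReal.ofReal_mul (by positivity), ← ENNReal.ofReal_mul (by positivity),
          ← ENNReal.ofReal_mul (by linarith), Real.mul_rpow (by positivity) hM.le]
        congr 1
        rw [show M ^ q = M ^ (q - 2) * M ^ 2 by
          rw [← Real.rpow_natCast M 2, ← Real.rpow_add hM]; congr 1; push_cast; ring]
        ring

open FourierTransform in
/-- The fractional Sobolev inequality on the Fourier side. -/
theorem SobolevMult.eLpNorm_fourierInv_le {n : ℕ} [NeZero n] {t : ℝ} (ht : 0 < t)
    (h2t : 2 * t < n) :
    ∃ C : ℝ, 0 < C ∧ ∀ (h g : Lp ℂ 2 (volume : Measure (SobolevMult.Euc n))),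
      (∀ᵐ ξ, ‖ξ‖ ^ t * ‖h ξ‖ ≤ ‖g ξ‖) →
      eLpNorm (𝓕⁻ h : Lp ℂ 2 (volume : Measure (SobolevMult.Euc n)))
        (ENNReal.ofReal (2 * n / (n - 2 * t))) volume ≤ ENNReal.ofReal (C * ‖g‖) := by
  obtain ⟨C, hC, hCb⟩ := SobolevMult.lintegral_fourierInv_rpow_le (n := n) ht h2t
  have hn : (0 : ℝ) < n := by linarith
  have hq : (0 : ℝ) < 2 * n / (n - 2 * t) := div_pos (by positivity) (by linarith)
  set q : ℝ := 2 * n / (n - 2 * t)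
  refine ⟨C ^ (1 / q), by positivity, fun h g hhg ↦ ?_⟩
  -- The cutoff divides by `M`, whereas `‖g‖` may vanish; the bound is proved for `M > ‖g‖` and then
  -- `M` decreases to `‖g‖`.
  have hM : ∀ M : ℝ, ‖g‖ < M →
      eLpNorm (𝓕⁻ h : Lp ℂ 2 (volume : Measure (SobolevMult.Euc n))) (ENNReal.ofReal q) volume ≤
        ENNReal.ofReal (C ^ (1 / q) * M) := by
    intro M hgM
    have hM0 : 0 < M := (norm_nonneg g).trans_lt hgM
    rw [eLpNorm_eq_lintegral_rpow_enorm_toReal (by simpa using hq) ENNReal.ofReal_ne_top,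
      ENNReal.toReal_ofReal hq.le]
    have e : ∀ x, ‖(𝓕⁻ h : Lp ℂ 2 (volume : Measure (SobolevMult.Euc n))) x‖ₑ ^ q =
        ENNReal.ofReal (‖(𝓕⁻ h : Lp ℂ 2 (volume : Measure (SobolevMult.Euc n))) x‖ ^ q) := by
      intro x
      rw [← ofReal_norm, ENNReal.ofReal_rpow_of_nonneg (norm_nonneg _) hq.le]
    simp_rw [e]
    refine (ENNReal.rpow_le_rpow (hCb h g hhg M hM0 hgM.le) (by positivity)).trans (le_of_eq ?_)
    rw [ENNReal.ofReal_rpow_of_nonneg (by positivity) (by positivity),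
      Real.mul_rpow hC.le (by positivity), ← Real.rpow_mul hM0.le, mul_one_div_cancel hq.ne',
      Real.rpow_one]
  have hlim : Filter.Tendsto (fun M : ℝ ↦ ENNReal.ofReal (C ^ (1 / q) * M))
      (nhdsWithin ‖g‖ (Set.Ioi ‖g‖)) (nhds (ENNReal.ofReal (C ^ (1 / q) * ‖g‖))) :=
    (ENNReal.continuous_ofReal.comp (continuous_const.mul continuous_id)).continuousWithinAt
  exact ge_of_tendsto hlim (Filter.eventually_of_mem self_mem_nhdsWithin hM)

open FourierTransform in
/-- The Sobolev embedding `H^s(ℝⁿ) ⊂ L^q(ℝⁿ)`, `1 / q = 1 / 2 - t / n`, for `0 < t ≤ s`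
and `t < n / 2`. -/
theorem SobolevMult.HasBessel.eLpNorm_le {n : ℕ} [NeZero n] {s t : ℝ} (ht : 0 < t) (hts : t ≤ s)
    (h2t : 2 * t < n) :
    ∃ C : ℝ, 0 < C ∧ ∀ F G : Lp ℂ 2 (volume : Measure (SobolevMult.Euc n)),
      SobolevMult.HasBessel s F G →
      eLpNorm F (ENNReal.ofReal (2 * n / (n - 2 * t))) volume ≤ ENNReal.ofReal (C * ‖G‖) := by
  obtain ⟨C, hC, hCb⟩ := SobolevMult.eLpNorm_fourierInv_le (n := n) ht h2t
  refine ⟨C, hC, fun F G hFG ↦ ?_⟩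
  have := hCb (𝓕 F) (𝓕 G) ?_
  · rwa [fourierInv_fourier_eq, Lp.norm_fourier_eq] at this
  filter_upwards [hFG.fourier_ae_eq (ht.le.trans hts)] with ξ hξ
  rw [hξ, norm_mul, Complex.norm_real, Real.norm_eq_abs, abs_of_nonneg (by positivity), ← mul_assoc]
  refine mul_le_of_le_one_left (norm_nonneg _) ?_
  have h1 : ‖ξ‖ ^ t ≤ (1 + ‖ξ‖ ^ 2) ^ (s / 2) := by
    calc ‖ξ‖ ^ t = (‖ξ‖ ^ 2) ^ (t / 2) := by
          rw [← Real.rpow_natCast, ← Real.rpow_mul (norm_nonneg _)]; congr 1; push_cast; ring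
      _ ≤ (1 + ‖ξ‖ ^ 2) ^ (t / 2) := by gcongr; linarith
      _ ≤ (1 + ‖ξ‖ ^ 2) ^ (s / 2) :=
          Real.rpow_le_rpow_of_exponent_le (by nlinarith [sq_nonneg ‖ξ‖]) (by linarith)
  rw [neg_div, Real.rpow_neg (by positivity), ← div_eq_mul_inv]
  exact div_le_one_of_le₀ h1 (by positivity)

/-! ### Multiplication by functions in `L^p`. -/

/-- Multiplication by a bounded function is bounded on `L²`. -/
theorem eLpNorm_mul_two_le_of_bound {α : Type*} [MeasurableSpace α] {μ : Measure α} {S f : α → ℂ}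
    {B : ℝ} (hB : ∀ᵐ x ∂μ, ‖S x‖ ≤ B) :
    eLpNorm (fun x ↦ S x * f x) 2 μ ≤ ENNReal.ofReal B * eLpNorm f 2 μ := by
  refine eLpNorm_le_mul_eLpNorm_of_ae_le_mul ?_ 2
  filter_upwards [hB] with x hx
  rw [norm_mul]
  gcongr

/-- The constant is chosen before the extension `F`, which later permits the infimum over all
extensions. -/
theorem SobolevMult.exists_eLpNorm_mul_le {n : ℕ} [NeZero n] {Ω : Opens (SobolevMult.Euc n)}
    {s : ℝ} {p : ℝ≥0∞} {W : SobolevMult.Euc n → ℂ} (hs : 0 < s) (hp2 : 2 < p)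
    (hps : ENNReal.ofReal (n / s) ≤ p)
    (hW : MemLp W p (volume.restrict (Ω : Set (SobolevMult.Euc n)))) {ε : ℝ} (hε : 0 < ε) :
    ∃ C : ℝ, 0 < C ∧ ∀ (f : SobolevMult.L2 Ω) (F G : Lp ℂ 2 (volume : Measure (SobolevMult.Euc n))),
      SobolevMult.HasBessel s F G → SobolevMult.Restricts F f →
      eLpNorm (fun x ↦ W x * f x) 2 (volume.restrict (Ω : Set (SobolevMult.Euc n))) ≤
        ENNReal.ofReal (ε * ‖G‖ + C * ‖f‖) := by
  set μ := (volume : Measure (SobolevMult.Euc n)).restrict (Ω : Set (SobolevMult.Euc n)) with hμ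
  have hfn : ∀ f : SobolevMult.L2 Ω, eLpNorm f 2 μ = ENNReal.ofReal ‖f‖ := fun f ↦ by
    rw [Lp.norm_def, ENNReal.ofReal_toReal (Lp.eLpNorm_ne_top f)]
  rcases eq_or_ne p ∞ with rfl | hp
  · have hB : ∀ᵐ x ∂μ, ‖W x‖ ≤ (eLpNorm W ∞ μ).toReal + 1 := by
      have hWe := hW.eLpNorm_ne_top
      filter_upwards [enorm_ae_le_eLpNormEssSup W μ] with x hx
      rw [← eLpNorm_exponent_top] at hx
      have := ENNReal.toReal_mono hWe hx
      rw [toReal_enorm] at this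
      linarith
    refine ⟨(eLpNorm W ∞ μ).toReal + 1, by positivity, fun f F G _ _ ↦ ?_⟩
    refine (eLpNorm_mul_two_le_of_bound hB).trans ?_
    rw [hfn, ← ENNReal.ofReal_mul (by positivity)]
    refine ENNReal.ofReal_le_ofReal ?_
    have : 0 ≤ ε * ‖G‖ := by positivity
    linarith
  have hn : (0 : ℝ) < n := Nat.cast_pos.2 (Nat.pos_of_ne_zero (NeZero.ne n))
  have hr : 2 < p.toReal := by
    rw [← ENNReal.toReal_ofNat 2]
    exact (ENNReal.toReal_lt_toReal (by norm_num) hp).2 hp2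
  set r := p.toReal
  have hpr : p = ENNReal.ofReal r := (ENNReal.ofReal_toReal hp).symm
  have hts : n / r ≤ s := by
    rw [hpr, ENNReal.ofReal_le_ofReal_iff (by linarith), div_le_iff₀ hs] at hps
    rw [div_le_iff₀ (by linarith)]
    linarith
  have ht : 0 < n / r := div_pos hn (by linarith)
  have h2t : 2 * (n / r) < n := by
    rw [← mul_div_assoc, div_lt_iff₀ (by linarith)]
    nlinarith
  -- The order `t = n / r` is the one whose Sobolev exponent is Hölder-dual to `p` relative to `2`;
  -- `p ≥ n/s` gives `t ≤ s`, and `p > 2` gives `2t < n`.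
  obtain ⟨C, hC, hCb⟩ := SobolevMult.HasBessel.eLpNorm_le (n := n) ht hts h2t
  have hd : 0 < n - 2 * (n / r) := by linarith
  have hq0 : 0 < 2 * n / (n - 2 * (n / r)) := by positivity
  have hq : 2 * n / (n - 2 * (n / r)) = 2 * r / (r - 2) := by
    have : r - 2 ≠ 0 := by linarith
    have : r ≠ 0 := by linarith
    field_simp
  have hH : ENNReal.HolderTriple p (ENNReal.ofReal (2 * n / (n - 2 * (n / r)))) 2 := by
    constructor
    rw [hpr, ← ENNReal.ofReal_inv_of_pos (by linarith), ← ENNReal.ofReal_inv_of_pos hq0,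
      ← ENNReal.ofReal_add (by positivity) (by positivity), hq,
      show (2 : ℝ≥0∞) = ENNReal.ofReal 2 by simp, ← ENNReal.ofReal_inv_of_pos (by norm_num)]
    congr 1
    have : r - 2 ≠ 0 := by linarith
    field_simp
    ring
  -- The tolerance `ε / C` cancels the Sobolev constant `C`.
  obtain ⟨S, hS, -⟩ := hW.exists_simpleFunc_eLpNorm_sub_lt hp
    (ε := ENNReal.ofReal (ε / C)) (by simpa using div_pos hε hC)
  obtain ⟨B, hB⟩ := S.exists_forall_norm_le
  refine ⟨|B| + 1, by positivity, fun f F G hFG hFf ↦ ?_⟩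
  have hWS : AEStronglyMeasurable (W - ⇑S) μ := hW.1.sub S.aestronglyMeasurable
  have hfF : eLpNorm f (ENNReal.ofReal (2 * n / (n - 2 * (n / r)))) μ ≤
      ENNReal.ofReal (C * ‖G‖) := by
    rw [← eLpNorm_congr_ae hFf]
    exact (eLpNorm_mono_measure _ Measure.restrict_le_self).trans (hCb F G hFG)
  have h1 : eLpNorm (fun x ↦ (W - ⇑S) x * f x) 2 μ ≤
      ENNReal.ofReal (ε / C) * ENNReal.ofReal (C * ‖G‖) :=
    (eLpNorm_smul_le_mul_eLpNorm (Lp.aestronglyMeasurable f) hWS).trans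
      (mul_le_mul' hS.le hfF)
  have h2 : eLpNorm (fun x ↦ S x * f x) 2 μ ≤ ENNReal.ofReal (|B| + 1) * ENNReal.ofReal ‖f‖ := by
    rw [← hfn]
    refine eLpNorm_mul_two_le_of_bound (.of_forall fun x ↦ (hB x).trans ?_)
    linarith [le_abs_self B]
  have hsplit : (fun x ↦ W x * f x) = (fun x ↦ (W - ⇑S) x * f x) + fun x ↦ S x * f x := by
    ext x
    simp only [Pi.sub_apply, Pi.add_apply]
    ring
  rw [hsplit]
  refine (eLpNorm_add_le (hWS.mul (Lp.aestronglyMeasurable f))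
    (S.aestronglyMeasurable.mul (Lp.aestronglyMeasurable f)) (by norm_num)).trans ?_
  refine (add_le_add h1 h2).trans (le_of_eq ?_)
  rw [← ENNReal.ofReal_mul (by positivity), ← ENNReal.ofReal_mul (by positivity),
    ← ENNReal.ofReal_add (by positivity) (by positivity)]
  congr 2
  field_simp

theorem SobolevMult.mulBound_of_memLp {n : ℕ} [NeZero n] {Ω : Opens (SobolevMult.Euc n)}
    {s : ℝ} {p : ℝ≥0∞} {W : SobolevMult.Euc n → ℂ} (hs : 0 < s) (hp2 : 2 < p)
    (hps : ENNReal.ofReal (n / s) ≤ p)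
    (hW : MemLp W p (volume.restrict (Ω : Set (SobolevMult.Euc n)))) :
    SobolevMult.MulBound s Ω W := by
  have hmem : ∀ f ∈ SobolevMult.Hs s Ω,
      MemLp (fun x ↦ W x * f x) 2 (volume.restrict (Ω : Set (SobolevMult.Euc n))) := by
    rintro f ⟨F, ⟨G, hFG⟩, hFf⟩
    obtain ⟨C, -, hC⟩ := SobolevMult.exists_eLpNorm_mul_le hs hp2 hps hW one_pos
    exact ⟨hW.1.mul (Lp.aestronglyMeasurable f), (hC f F G hFG hFf).trans_lt ENNReal.ofReal_lt_top⟩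
  have hconj : ∀ f : SobolevMult.Euc n → ℂ, ∀ x, ‖W x * f x‖ = ‖conj (W x) * f x‖ := by
    intro f x
    rw [norm_mul, norm_mul, RCLike.norm_conj]
  refine ⟨fun f hf ↦ ⟨hmem f hf, (hmem f hf).congr_norm ?_ (.of_forall (hconj f))⟩, ?_⟩
  · exact (Complex.continuous_conj.comp_aestronglyMeasurable hW.1).mul (Lp.aestronglyMeasurable f)
  intro ε hε
  obtain ⟨C, hC0, hC⟩ := SobolevMult.exists_eLpNorm_mul_le hs hp2 hps hW hε
  refine ⟨C, hC0, fun f hf ↦ ⟨?_, ?_⟩⟩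
  · rw [eLpNorm_congr_norm_ae (.of_forall (hconj f))]
  obtain ⟨F₀, ⟨G₀, hFG₀⟩, hFf₀⟩ := hf
  set N := (eLpNorm (fun x ↦ W x * f x) 2
    ((volume : Measure (SobolevMult.Euc n)).restrict (Ω : Set (SobolevMult.Euc n)))).toReal
  -- Solving for the norm of the extension turns the estimate into a lower bound for the set whose
  -- infimum is `hsNorm`.
  have : (N - C * ‖f‖) / ε ≤ SobolevMult.hsNorm s f := by
    refine le_csInf ⟨_, F₀, G₀, hFG₀, hFf₀, rfl⟩ ?_
    rintro _ ⟨F, G, hFG, hFf, rfl⟩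
    have := ENNReal.toReal_mono ENNReal.ofReal_ne_top (hC f F G hFG hFf)
    rw [ENNReal.toReal_ofReal (by positivity)] at this
    rw [div_le_iff₀ hε]
    linarith
  rw [div_le_iff₀ hε] at this
  linarith

/-! ### Distributions given by `L²` functions -/

theorem SobolevMult.locallyIntegrableOn_of_memLp {n : ℕ} {Ω : Opens (SobolevMult.Euc n)}
    {u : SobolevMult.Euc n → ℂ}
    (hu : MemLp u 2 (volume.restrict (Ω : Set (SobolevMult.Euc n)))) :
    LocallyIntegrableOn u Ω (volume.restrict (Ω : Set (SobolevMult.Euc n))) :=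
  (hu.locallyIntegrable (by norm_num)).locallyIntegrableOn _

theorem SobolevMult.toDistr_apply {n : ℕ} {Ω : Opens (SobolevMult.Euc n)}
    {u : SobolevMult.Euc n → ℂ}
    (hu : MemLp u 2 (volume.restrict (Ω : Set (SobolevMult.Euc n)))) (φ : 𝓓(Ω, ℝ)) :
    SobolevMult.toDistr Ω u φ = ∫ x in (Ω : Set (SobolevMult.Euc n)), φ x • u x :=
  TestFunction.integralAgainstBilinCLM_eq_integral (SobolevMult.locallyIntegrableOn_of_memLp hu)

theorem SobolevMult.toDistr_congr {n : ℕ} {Ω : Opens (SobolevMult.Euc n)}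
    {u v : SobolevMult.Euc n → ℂ}
    (hu : MemLp u 2 (volume.restrict (Ω : Set (SobolevMult.Euc n))))
    (huv : u =ᵐ[volume.restrict (Ω : Set (SobolevMult.Euc n))] v) :
    SobolevMult.toDistr Ω u = SobolevMult.toDistr Ω v := by
  ext φ
  rw [SobolevMult.toDistr_apply hu, SobolevMult.toDistr_apply (hu.ae_eq huv)]
  exact integral_congr_ae (huv.mono fun x hx ↦ by simp only [hx])

theorem SobolevMult.toDistr_add {n : ℕ} {Ω : Opens (SobolevMult.Euc n)} (f g : SobolevMult.L2 Ω) :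
    SobolevMult.toDistr Ω (f + g : SobolevMult.L2 Ω) =
      SobolevMult.toDistr Ω f + SobolevMult.toDistr Ω g := by
  have hint : ∀ (u : SobolevMult.L2 Ω) (φ : 𝓓(Ω, ℝ)),
      Integrable (fun x ↦ φ x • u x) (volume.restrict (Ω : Set (SobolevMult.Euc n))) :=
    fun u φ ↦ ((Lp.memLp u).locallyIntegrable (by norm_num)).integrable_smul_left_of_hasCompactSupport
      φ.continuous φ.hasCompactSupport
  rw [SobolevMult.toDistr_congr (Lp.memLp _) (Lp.coeFn_add f g)]
  ext φ
  rw [add_apply, SobolevMult.toDistr_apply ((Lp.memLp f).add (Lp.memLp g)),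
    SobolevMult.toDistr_apply (Lp.memLp f), SobolevMult.toDistr_apply (Lp.memLp g),
    ← integral_add (hint f φ) (hint g φ)]
  simp only [Pi.add_apply, smul_add]

theorem SobolevMult.toDistr_neg {n : ℕ} {Ω : Opens (SobolevMult.Euc n)} (f : SobolevMult.L2 Ω) :
    SobolevMult.toDistr Ω (-f : SobolevMult.L2 Ω) = -SobolevMult.toDistr Ω f := by
  rw [SobolevMult.toDistr_congr (Lp.memLp _) (Lp.coeFn_neg f)]
  ext φ
  rw [neg_apply, SobolevMult.toDistr_apply (Lp.memLp f).neg,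
    SobolevMult.toDistr_apply (Lp.memLp f), ← integral_neg]
  simp only [Pi.neg_apply, smul_neg]

theorem SobolevMult.InL2.add {n : ℕ} {Ω : Opens (SobolevMult.Euc n)} {S T : 𝓓'(Ω, ℂ)}
    (hS : SobolevMult.InL2 S) (hT : SobolevMult.InL2 T) : SobolevMult.InL2 (S + T) := by
  obtain ⟨f, rfl⟩ := hS
  obtain ⟨g, rfl⟩ := hT
  exact ⟨f + g, (SobolevMult.toDistr_add f g).symm⟩

theorem SobolevMult.InL2.neg {n : ℕ} {Ω : Opens (SobolevMult.Euc n)} {T : 𝓓'(Ω, ℂ)}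
    (hT : SobolevMult.InL2 T) : SobolevMult.InL2 (-T) := by
  obtain ⟨f, rfl⟩ := hT
  exact ⟨-f, (SobolevMult.toDistr_neg f).symm⟩

theorem SobolevMult.inL2_toDistr {n : ℕ} {Ω : Opens (SobolevMult.Euc n)}
    {u : SobolevMult.Euc n → ℂ}
    (hu : MemLp u 2 (volume.restrict (Ω : Set (SobolevMult.Euc n)))) :
    SobolevMult.InL2 (SobolevMult.toDistr Ω u) :=
  ⟨hu.toLp, SobolevMult.toDistr_congr hu hu.coeFn_toLp.symm⟩

/-- `V f` is itself in `L²(Ω)`, so it can be added to or subtracted from `-Δ f` freely. -/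
theorem SobolevMult.hsLaplace_eq_hsSchrodinger {n : ℕ} {s : ℝ} {Ω : Opens (SobolevMult.Euc n)}
    {V : SobolevMult.Euc n → ℂ}
    (hV : ∀ f ∈ SobolevMult.Hs s Ω,
      MemLp (fun x ↦ V x * f x) 2 (volume.restrict (Ω : Set (SobolevMult.Euc n)))) :
    SobolevMult.HsLaplace s Ω = SobolevMult.HsSchrodinger s Ω V := by
  ext f
  refine and_congr_right fun hf ↦ ⟨fun h ↦ h.neg.add (SobolevMult.inL2_toDistr (hV f hf)),
    fun h ↦ ?_⟩
  have := (h.add (SobolevMult.inL2_toDistr (hV f hf)).neg).neg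
  rwa [add_neg_cancel_right, neg_neg] at this

theorem lemma3p2 {n : ℕ} (hn : 2 ≤ n) (Ω : Opens (SobolevMult.Euc n))
    (hΩ : SobolevMult.IsBoundedLipschitz Ω ∨ SobolevMult.IsExteriorLipschitz Ω) :
    (∀ (s : ℝ) (p : ℝ≥0∞) (W : SobolevMult.Euc n → ℂ), 0 < s →
      (2 * s < (n : ℝ) → ENNReal.ofReal ((n : ℝ) / s) ≤ p) →
      ((n : ℝ) ≤ 2 * s → 2 < p) →
      MemLp W p (volume.restrict (Ω : Set (SobolevMult.Euc n))) →
      SobolevMult.MulBound s Ω W) ∧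
    (∀ (p : ℝ≥0∞) (V : SobolevMult.Euc n → ℂ),
      (3 < n → ENNReal.ofReal (2 * (n : ℝ) / 3) ≤ p) →
      (n ≤ 3 → 2 < p) →
      MemLp V p (volume.restrict (Ω : Set (SobolevMult.Euc n))) →
      SobolevMult.MulBound (3 / 2) Ω V ∧
      SobolevMult.HsLaplace (3 / 2) Ω = SobolevMult.HsSchrodinger (3 / 2) Ω V ∧
      SobolevMult.HsLaplace (3 / 2) Ω =
        SobolevMult.HsSchrodinger (3 / 2) Ω (fun x ↦ conj (V x))) := by
  have : NeZero n := ⟨by omega⟩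
  have main : ∀ (s : ℝ) (p : ℝ≥0∞) (W : SobolevMult.Euc n → ℂ), 0 < s →
      (2 * s < (n : ℝ) → ENNReal.ofReal ((n : ℝ) / s) ≤ p) →
      ((n : ℝ) ≤ 2 * s → 2 < p) →
      MemLp W p (volume.restrict (Ω : Set (SobolevMult.Euc n))) →
      SobolevMult.MulBound s Ω W := by
    intro s p W hs h1 h2 hW
    -- Both cases give `p > 2` and `p ≥ n/s`: if `2s < n` then `n/s > 2`, and otherwise `n/s ≤ 2 <
    -- p`.
    rcases lt_or_ge (2 * s) n with h | h
    · refine SobolevMult.mulBound_of_memLp hs (lt_of_lt_of_le ?_ (h1 h)) (h1 h) hW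
      rw [show (2 : ℝ≥0∞) = ENNReal.ofReal 2 by simp,
        ENNReal.ofReal_lt_ofReal_iff_of_nonneg (by norm_num), lt_div_iff₀ hs]
      exact h
    · refine SobolevMult.mulBound_of_memLp hs (h2 h) (le_trans ?_ (h2 h).le) hW
      rw [show (2 : ℝ≥0∞) = ENNReal.ofReal 2 by simp]
      exact ENNReal.ofReal_le_ofReal ((div_le_iff₀ hs).2 h)
  refine ⟨main, fun p V h1 h2 hV ↦ ?_⟩
  have hb : SobolevMult.MulBound (3 / 2) Ω V := by
    refine main (3 / 2) p V (by norm_num) (fun h ↦ ?_) (fun h ↦ h2 ?_) hV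
    · rw [show (n : ℝ) / (3 / 2) = 2 * n / 3 by ring]
      refine h1 ?_
      norm_num at h
      exact_mod_cast h
    · norm_num at h
      exact_mod_cast h
  exact ⟨hb, SobolevMult.hsLaplace_eq_hsSchrodinger fun f hf ↦ (hb.1 f hf).1,
    SobolevMult.hsLaplace_eq_hsSchrodinger fun f hf ↦ (hb.1 f hf).2⟩
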